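/- Let $G$ be an abelian group with a translation-invariant partial order $\le$, and put $G^+=\{x\in G: x\ge 0\}$; write $x<y$ if $x\le y$ and $x\ne y$. An order unit of $G$ is a nonzero $v\in G^+$ such that for each $g\in G$ there is an integer $N\ge 1$ with $-Nv\le g\le Nv$. Suppose that $G$ is a simple dimension group with order unit $u$, that is: - $G\neq\{0\}$, every finite subset of $G$ has an upper bound in $G$, and every nonzero element of $G^+$ is an order unit; - $G$ is unperforated: if $mg\ge 0$ with $g\in G$ and an integer $m\ge 1$, then $g\ge 0$; - $G$ has the Riesz interpolation property: if $g_i\le g'_j$ for all $i,j\in\{1,2\}$, there is $g\in G$ with $g_i\le g\le g'_j$ for all $i,j\in\{1,2\}$; - $u$ is an order unit of $G$. Let $S(G,u)\subseteq\mathbb{R}^G$ be the set of group homomorphisms $\tau\colon G\to\mathbb{R}$ with $\tau(G^+)\subseteq[0,\infty)$ and $\tau(u)=1$ (the traces normalized at $u$), with the topology induced by the product topology of $\mathbb{R}^G$, and let $\operatorname{Aff} S(G,u)$ be the real vector space of continuous functions $S(G,u)\to\mathbb{R}$ that preserve convex combinations. For a subgroup $H$ of $G$, put $Z_G(H)=\{\sigma\in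 S(G,u): \sigma(h)=0\text{ for all }h\in H\}$. A trace $\tau\in S(G,u)$ is called - *refinable* if, whenever $a_1,a_2,b\in G^+$ satisfy $\tau(a_1)+\tau(a_2)=\tau(b)$, there exist $a_1',a_2'\in G^+$ with $a_1'+a_2'=b$ and $\tau(a_i')=\tau(a_i)$ for $i=1,2$; - *good* if, whenever $a\in G$ and $b\in G^+\setminus\{0\}$ satisfy $0<\tau(a)<\tau(b)$, there exists $a'\in G^+\setminus\{0\}$ with $a'<b$ and $\tau(a')=\tau(a)$. **Corollary 8.2.** Assume that $\operatorname{Aff} S(G,u)$ is finite-dimensional, and let $\tau\in S(G,u)$. Then $\tau$ is good if and only if $\tau$ is refinable and $Z_G(\ker\tau)=\{\tau\}$. -/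

import Mathlib

namespace POGroup

section Groups

variable (G : Type*) [AddCommGroup G] [PartialOrder G]

/-- `u` is an order unit: a nonzero positive element such that every `g` satisfies
`-N u ≤ g ≤ N u` for some positive integer `N`. -/
def IsOrderUnit {G : Type*} [AddCommGroup G] [PartialOrder G] (u : G) : Prop :=
  u ≠ 0 ∧ 0 ≤ u ∧ ∀ g : G, ∃ N : ℕ, 0 < N ∧ -(N • u) ≤ g ∧ g ≤ N • u

/-- Every finite subset of `G` has an upper bound. -/
def Directed : Prop :=
  ∀ s : Finset G, BddAbove (s : Set G)

/-- A simple partially ordered abelian group: nonzero, directed, and the nonzero positive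
elements are exactly the order units. -/
def Simple : Prop :=
  Nontrivial G ∧ Directed G ∧ {g : G | 0 ≤ g ∧ g ≠ 0} = {g : G | IsOrderUnit g}

/-- `m g ≥ 0` for some positive integer `m` implies `g ≥ 0`. -/
def Unperforated : Prop :=
  ∀ (g : G) (m : ℕ), 0 < m → 0 ≤ m • g → 0 ≤ g

/-- The Riesz interpolation property. -/
def RieszInterpolation : Prop :=
  ∀ g₁ g₂ k₁ k₂ : G, g₁ ≤ k₁ → g₁ ≤ k₂ → g₂ ≤ k₁ → g₂ ≤ k₂ →
    ∃ g : G, g₁ ≤ g ∧ g₂ ≤ g ∧ g ≤ k₁ ∧ g ≤ k₂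

/-- A dimension group. -/
def DimensionGroup : Prop :=
  Directed G ∧ Unperforated G ∧ RieszInterpolation G

end Groups

/-- The vector space of continuous real-valued functions on the subset `K` of a real topological
vector space that respect convex combinations. -/
def Aff {E : Type*} [AddCommGroup E] [Module ℝ E] [TopologicalSpace E] (K : Set E) :
    Submodule ℝ C(K, ℝ) where
  carrier := {f | ∀ (x y z : K) (t : ℝ), 0 ≤ t → t ≤ 1 →
    (z : E) = (1 - t) • (x : E) + t • (y : E) → f z = (1 - t) * f x + t * f y}
  zero_mem' := by
    intro x y z t _ _ _
    simp
  add_mem' := by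
    intro f g hf hg x y z t h0 h1 h
    have h2 := hf x y z t h0 h1 h
    have h3 := hg x y z t h0 h1 h
    simp only [ContinuousMap.add_apply, h2, h3]
    ring
  smul_mem' := by
    intro c f hf x y z t h0 h1 h
    have h2 := hf x y z t h0 h1 h
    simp only [ContinuousMap.smul_apply, smul_eq_mul, h2]
    ring

section Traces

variable {G : Type*} [AddCommGroup G] [PartialOrder G]

/-- A trace: a nonzero positive group homomorphism to `ℝ`. -/
def IsTrace (τ : G →+ ℝ) : Prop :=
  τ ≠ 0 ∧ ∀ g : G, 0 ≤ g → 0 ≤ τ g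

/-- `S(G, u)`: the set of traces normalized at `u`. -/
def traceSpace (u : G) : Set (G →+ ℝ) :=
  {τ | IsTrace τ ∧ τ u = 1}

/-- `S(G, u)` as a subset of `ℝ ^ G`, which carries the product topology. -/
def traceFunctions (u : G) : Set (G → ℝ) :=
  (fun (τ : G →+ ℝ) (g : G) => τ g) '' traceSpace u

/-- `Z_G(H)`: the set of normalized traces that vanish on `H`. -/
def annihilatingTraces (u : G) (H : AddSubgroup G) : Set (G →+ ℝ) :=
  {τ | τ ∈ traceSpace u ∧ ∀ h ∈ H, τ h = 0}

/-- Refinability of a nonempty set `U` of normalized traces. -/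
def Refinable (U : Set (G →+ ℝ)) : Prop :=
  ∀ a₁ a₂ b : G, 0 ≤ a₁ → 0 ≤ a₂ → 0 ≤ b → (∀ τ ∈ U, τ a₁ + τ a₂ = τ b) →
    ∃ a₁' a₂' : G, 0 ≤ a₁' ∧ 0 ≤ a₂' ∧ a₁' + a₂' = b ∧
      ∀ τ ∈ U, τ a₁' = τ a₁ ∧ τ a₂' = τ a₂

/-- Goodness of a nonempty set `U` of normalized traces. The two infima are over nonempty
bounded sets, since each `g` satisfies `-N u ≤ g ≤ N u` for some `N`. -/
def Good (U : Set (G →+ ℝ)) : Prop :=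
  ∀ a b : G, 0 ≤ b → b ≠ 0 →
    0 < (⨅ τ : U, (τ : G →+ ℝ) a) →
    0 < (⨅ τ : U, ((τ : G →+ ℝ) b - (τ : G →+ ℝ) a)) →
    ∃ a' : G, 0 ≤ a' ∧ a' ≠ 0 ∧ a' < b ∧ ∀ τ ∈ U, τ a' = τ a

/-- A single trace is refinable if the corresponding singleton is. -/
def IsRefinableTrace (τ : G →+ ℝ) : Prop := Refinable {τ}

/-- A single trace is good if the corresponding singleton is. -/
def IsGoodTrace (τ : G →+ ℝ) : Prop := Good {τ}

end Traces

end POGroup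

/-! If `τ` is good, refinability follows by applying goodness to `a₁` below `b`. Moreover every `g`
with `τ g > 0` agrees modulo `ker τ` with a positive element, so a trace vanishing on `ker τ` is
nonnegative wherever `τ` is positive, and comparison with rational multiples of `u` forces it to
equal `τ`.

For the converse, a cyclic group is immediate, so let `G` be noncyclic. By Riesz decomposition
distinct extreme traces are disjoint, hence linearly independent; finite dimensionality then leaves
finitely many, `T i`, whose convex hull is the whole trace space. The map `g ↦ (T i g)` has dense
image in `ℝ ^ ι`, because `G` has arbitrarily small positive elements that can be concentrated near
one coordinate. A Hahn-Banach argument shows that strict positivity of all coordinates implies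
positivity in `G`.

Let `L` be the closure of the image of `ker τ`. Refinability becomes a splitting property of `L`
(`IsRefinableTrace.isConformallySplitting`). Splitting makes arbitrarily small elements of `L` span
it, so `L` is determined by its annihilator, and makes that annihilator a sublattice. The condition
on `Z_G(ker τ)` says that its only probability vector is the coordinate vector `t` of `τ`; hence `L`
is the hyperplane orthogonal to `t` (`IsConformallySplitting.mem_closure`). Adding a suitable
element of `ker τ` to `a` then moves its coordinates close to those of `(τ a / τ b) b`, strictly
between `0` and those of `b`. -/

namespace POGroup

/-! ### Riesz decomposition and small positive elements -/

section Order

variable {G : Type*} [AddCommGroup G] [PartialOrder G]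

theorem Simple.isOrderUnit (hG : Simple G) {g : G} (h0 : 0 ≤ g) (h1 : g ≠ 0) :
    IsOrderUnit g := by
  have : g ∈ {g : G | 0 ≤ g ∧ g ≠ 0} := ⟨h0, h1⟩
  rw [hG.2.2] at this
  exact this

variable [IsOrderedAddMonoid G]

theorem RieszInterpolation.exists_decomposition (hG : RieszInterpolation G) {x a b : G}
    (hx : 0 ≤ x) (ha : 0 ≤ a) (hb : 0 ≤ b) (h : x ≤ a + b) :
    ∃ y z : G, y + z = x ∧ 0 ≤ y ∧ y ≤ a ∧ 0 ≤ z ∧ z ≤ b := by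
  obtain ⟨y, h1, h2, h3, h4⟩ := hG 0 (x - b) x a hx ha (sub_le_self x hb)
    (sub_le_iff_le_add.2 h)
  exact ⟨y, x - y, by abel, h1, h4, sub_nonneg.2 h3, sub_le_comm.1 h2⟩

theorem RieszInterpolation.exists_le_le_of_le_nsmul (hG : RieszInterpolation G) {a : G}
    (ha : 0 ≤ a) (N : ℕ) {x : G} (hx : 0 ≤ x) (hx0 : x ≠ 0) (h : x ≤ N • a) :
    ∃ d : G, 0 ≤ d ∧ d ≠ 0 ∧ d ≤ x ∧ d ≤ a := by
  induction N generalizing x with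
  | zero => exact absurd (le_antisymm (by simpa using h) hx) hx0
  | succ n ih =>
    rw [succ_nsmul] at h
    obtain ⟨y, z, hyz, hy, hya, hz, hza⟩ :=
      hG.exists_decomposition hx (nsmul_nonneg ha n) ha h
    by_cases hz0 : z = 0
    · subst hz0
      rw [add_zero] at hyz
      subst hyz
      exact ih hx hx0 hya
    · exact ⟨z, hz, hz0, by rw [← hyz]; exact le_add_of_nonneg_left hy, hza⟩

/-- Decomposing below `N • v` yields `N` pieces below `v`, and minimality makes each of them `0` or
`v`. -/
theorem RieszInterpolation.mem_zmultiples_of_le_nsmul (hG : RieszInterpolation G) {v : G}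
    (hv : 0 ≤ v) (hmin : ∀ c : G, 0 ≤ c → c ≤ v → c = 0 ∨ c = v) (N : ℕ) {x : G}
    (hx : 0 ≤ x) (h : x ≤ N • v) : x ∈ AddSubgroup.zmultiples v := by
  induction N generalizing x with
  | zero =>
    rw [le_antisymm (by simpa using h) hx]
    exact zero_mem _
  | succ n ih =>
    rw [succ_nsmul] at h
    obtain ⟨y, z, hyz, hy, hya, hz, hza⟩ :=
      hG.exists_decomposition hx (nsmul_nonneg hv n) hv h
    rw [← hyz]
    refine add_mem (ih hy hya) ?_
    rcases hmin z hz hza with rfl | rfl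
    · exact zero_mem _
    · exact AddSubgroup.mem_zmultiples _

/-- A simple group with interpolation is either infinite cyclic, generated by a positive element,
or every nonzero positive element dominates twice another one. -/
theorem Simple.cyclic_or_exists_two_nsmul_le (hG : Simple G) (hR : RieszInterpolation G) :
    (∃ v : G, 0 ≤ v ∧ ∀ g : G, g ∈ AddSubgroup.zmultiples v) ∨
      ∀ b : G, 0 ≤ b → b ≠ 0 → ∃ d : G, 0 ≤ d ∧ d ≠ 0 ∧ 2 • d ≤ b := by
  by_cases h : ∃ v : G, 0 ≤ v ∧ v ≠ 0 ∧ ∀ c : G, 0 ≤ c → c ≤ v → c = 0 ∨ c = v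
  · obtain ⟨v, hv, hv0, hmin⟩ := h
    refine Or.inl ⟨v, hv, fun g => ?_⟩
    obtain ⟨N, -, h1, h2⟩ := (hG.isOrderUnit hv hv0).2.2 g
    have h3 : g + N • v ∈ AddSubgroup.zmultiples v :=
      hR.mem_zmultiples_of_le_nsmul hv hmin (N + N) (by rw [← neg_le_iff_add_nonneg]; exact h1)
        (by rw [add_nsmul]; gcongr)
    have h4 : N • v ∈ AddSubgroup.zmultiples v :=
      nsmul_mem (AddSubgroup.mem_zmultiples v) N
    simpa using sub_mem h3 h4
  · push Not at h
    refine Or.inr fun b hb hb0 => ?_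
    obtain ⟨c, hc, hcb, hc0, hc1⟩ := h b hb hb0
    have hbc : 0 ≤ b - c := sub_nonneg.2 hcb
    -- Since `b - c` is an order unit, it has a common nonzero positive minorant with `c`; twice
    -- that minorant lies below `b`.
    obtain ⟨N, -, -, h2⟩ := (hG.isOrderUnit hbc (sub_ne_zero.2 hc1.symm)).2.2 c
    obtain ⟨d, hd, hd0, hdc, hdb⟩ := hR.exists_le_le_of_le_nsmul hbc N hc hc0 h2
    refine ⟨d, hd, hd0, ?_⟩
    calc 2 • d = d + d := two_nsmul d
      _ ≤ c + (b - c) := add_le_add hdc hdb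
      _ = b := by abel

theorem exists_two_pow_nsmul_le
    (h : ∀ b : G, 0 ≤ b → b ≠ 0 → ∃ d : G, 0 ≤ d ∧ d ≠ 0 ∧ 2 • d ≤ b) {b : G} (hb : 0 ≤ b)
    (hb0 : b ≠ 0) (n : ℕ) : ∃ d : G, 0 ≤ d ∧ d ≠ 0 ∧ 2 ^ n • d ≤ b := by
  induction n with
  | zero => exact ⟨b, hb, hb0, by simp⟩
  | succ n ih =>
    obtain ⟨d, hd, hd0, hdb⟩ := ih
    obtain ⟨e, he, he0, hed⟩ := h d hd hd0
    refine ⟨e, he, he0, le_trans ?_ hdb⟩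
    rw [pow_succ, mul_nsmul']
    exact nsmul_le_nsmul_right hed _

end Order

/-! ### Hahn-Banach for abelian groups -/

section Sublinear

variable {G : Type*} [AddCommGroup G]

/-- A subadditive real function on an abelian group that is homogeneous for natural multiples. -/
structure IsSublinear (p : G → ℝ) : Prop where
  add_le : ∀ x y, p (x + y) ≤ p x + p y
  nsmul : ∀ (n : ℕ) x, p (n • x) = n * p x

namespace IsSublinear

variable {p : G → ℝ}

theorem zero (hp : IsSublinear p) : p 0 = 0 := by
  simpa using hp.nsmul 0 0

theorem neg_le (hp : IsSublinear p) (x : G) : -p (-x) ≤ p x := by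
  have := hp.add_le x (-x)
  rw [add_neg_cancel, hp.zero] at this
  linarith

/-- The largest sublinear function below `p` that is additive in the direction `g`. -/
noncomputable def shift (p : G → ℝ) (g x : G) : ℝ :=
  ⨅ n : ℕ, (p (x + n • g) - n * p g)

theorem bddBelow_shift (hp : IsSublinear p) (g x : G) :
    BddBelow (Set.range fun n : ℕ => p (x + n • g) - n * p g) := by
  refine ⟨-p (-x), ?_⟩
  rintro _ ⟨n, rfl⟩
  have h1 := hp.add_le (x + n • g) (-x)
  rw [show x + n • g + -x = n • g by abel, hp.nsmul] at h1
  dsimp only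
  linarith

theorem shift_le_apply (hp : IsSublinear p) (g x : G) (n : ℕ) :
    shift p g x ≤ p (x + n • g) - n * p g :=
  ciInf_le (hp.bddBelow_shift g x) n

theorem shift_le (hp : IsSublinear p) (g x : G) : shift p g x ≤ p x := by
  simpa using hp.shift_le_apply g x 0

theorem isSublinear_shift (hp : IsSublinear p) (g : G) : IsSublinear (shift p g) where
  add_le x y := by
    refine le_ciInf_add_ciInf fun n m => (hp.shift_le_apply g (x + y) (n + m)).trans ?_
    have := hp.add_le (x + n • g) (y + m • g)
    rw [show x + n • g + (y + m • g) = x + y + (n + m) • g by rw [add_nsmul]; abel] at this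
    push_cast
    linarith
  nsmul k x := by
    rcases Nat.eq_zero_or_pos k with rfl | hk
    · simp [shift, hp.nsmul]
    have key : ∀ n : ℕ, p (k • x + (k * n) • g) - (k * n : ℕ) * p g
        = k * (p (x + n • g) - n * p g) := fun n => by
      rw [mul_nsmul', ← nsmul_add, hp.nsmul]
      push_cast
      ring
    apply le_antisymm
    · unfold shift
      rw [Real.mul_iInf_of_nonneg (Nat.cast_nonneg k)]
      refine le_ciInf fun n => ?_
      rw [← key]
      exact hp.shift_le_apply g (k • x) (k * n)
    · refine le_ciInf fun n => ?_
      have h1 : (k : ℝ) * shift p g x ≤ k * (p (x + n • g) - n * p g) :=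
        mul_le_mul_of_nonneg_left (hp.shift_le_apply g x n) (Nat.cast_nonneg k)
      rw [← key] at h1
      -- Adding `(k - 1) n` further copies of `g` turns `k • x + n • g` into `k • (x + n • g)`, at a
      -- cost of at most `(k - 1) n p(g)`.
      obtain ⟨j, rfl⟩ : ∃ j, k = j + 1 := ⟨k - 1, by omega⟩
      have h2 := hp.add_le ((j + 1) • x + n • g) ((j * n) • g)
      rw [hp.nsmul, show (j + 1) • x + n • g + (j * n) • g = (j + 1) • x + ((j + 1) * n) • g by
        rw [add_mul j 1 n, one_mul, add_nsmul g (j * n) n]; abel] at h2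
      push_cast at h1 h2 ⊢
      linarith

/-- The pointwise infimum works: of two members of the chain the smaller one is below both, which
gives subadditivity. -/
theorem exists_lowerBound_of_isChain {c : Set (G → ℝ)}
    (hc : c ⊆ {q | IsSublinear q ∧ q ≤ p}) (hchain : IsChain (· ≤ ·) c) {q₀ : G → ℝ}
    (hq₀ : q₀ ∈ c) : ∃ r ∈ {q | IsSublinear q ∧ q ≤ p}, ∀ q ∈ c, r ≤ q := by
  have : Nonempty c := ⟨⟨q₀, hq₀⟩⟩
  have hbdd : ∀ x, BddBelow (Set.range fun q : c => (q : G → ℝ) x) := fun x => by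
    refine ⟨-p (-x), ?_⟩
    rintro _ ⟨q, rfl⟩
    have h1 := (hc q.2).1.neg_le x
    have h2 := (hc q.2).2 (-x)
    dsimp only
    linarith
  refine ⟨fun x => ⨅ q : c, (q : G → ℝ) x, ⟨⟨fun x y => ?_, fun n x => ?_⟩, fun x => ?_⟩,
    fun q hq x => ciInf_le (hbdd x) ⟨q, hq⟩⟩
  · refine le_ciInf_add_ciInf fun q r => ?_
    rcases hchain.total q.2 r.2 with h | h
    · exact (ciInf_le (hbdd _) q).trans (((hc q.2).1.add_le x y).trans
        (add_le_add le_rfl (h y)))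
    · exact (ciInf_le (hbdd _) r).trans (((hc r.2).1.add_le x y).trans
        (add_le_add (h x) le_rfl))
  · rw [Real.mul_iInf_of_nonneg (Nat.cast_nonneg n)]
    exact iInf_congr fun q => (hc q.2).1.nsmul n x
  · exact (ciInf_le (hbdd x) ⟨q₀, hq₀⟩).trans ((hc hq₀).2 x)

/-- The analytic Hahn-Banach theorem for abelian groups. -/
theorem exists_addMonoidHom_le (hp : IsSublinear p) : ∃ f : G →+ ℝ, ∀ x, f x ≤ p x := by
  have hzorn : ∃ q, q ≤ p ∧ Minimal (· ∈ {q : G → ℝ | IsSublinear q ∧ q ≤ p}) q :=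
    @zorn_le_nonempty₀ (G → ℝ)ᵒᵈ _ {q : G → ℝ | IsSublinear q ∧ q ≤ p}
      (fun _ hc hchain _ hq => exists_lowerBound_of_isChain hc hchain.symm hq) p ⟨hp, le_rfl⟩
  obtain ⟨q, hqp, ⟨hq, -⟩, hmin⟩ := hzorn
  refine ⟨AddMonoidHom.mk' q fun x y => le_antisymm (hq.add_le x y) ?_, hqp⟩
  have h1 : q ≤ shift q y :=
    hmin ⟨hq.isSublinear_shift y, fun z => (hq.shift_le y z).trans (hqp z)⟩ (hq.shift_le y)
  -- The term `n = 1` of the shift gives `q x ≤ q (x + y) - q y`, the missing half of additivity.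
  have h2 := (h1 x).trans (hq.shift_le_apply y x 1)
  simp only [one_nsmul, Nat.cast_one, one_mul] at h2
  linarith

/-- A homomorphism below `shift p g` is also below `p`, and `shift p g (-g) ≤ -p g` forces equality
at `g`. -/
theorem exists_addMonoidHom_le_apply_eq (hp : IsSublinear p) (g : G) :
    ∃ f : G →+ ℝ, (∀ x, f x ≤ p x) ∧ f g = p g := by
  obtain ⟨f, hf⟩ := (hp.isSublinear_shift g).exists_addMonoidHom_le
  have h1 : ∀ x, f x ≤ p x := fun x => (hf x).trans (hp.shift_le g x)
  refine ⟨f, h1, le_antisymm (h1 g) ?_⟩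
  have h2 := (hf (-g)).trans (hp.shift_le_apply g (-g) 1)
  simp only [one_nsmul, neg_add_cancel, hp.zero, Nat.cast_one, one_mul, map_neg] at h2
  linarith

end IsSublinear

end Sublinear

/-! ### The order-unit gauge and detection of positivity by traces -/

section Gauge

variable {G : Type*} [AddCommGroup G] [PartialOrder G]

/-- The infimum of the rational numbers `k / m` with `m x ≤ k u`. -/
noncomputable def gauge (u x : G) : ℝ :=
  ⨅ q : {q : ℤ × ℕ // 0 < q.2 ∧ q.2 • x ≤ q.1 • u}, (q.1.1 : ℝ) / q.1.2

variable {u : G}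

theorem IsOrderUnit.nonempty_gauge (hu : IsOrderUnit u) (x : G) :
    Nonempty {q : ℤ × ℕ // 0 < q.2 ∧ q.2 • x ≤ q.1 • u} := by
  obtain ⟨N, -, -, h⟩ := hu.2.2 x
  exact ⟨⟨(N, 1), one_pos, by simpa using h⟩⟩

variable [IsOrderedAddMonoid G]

theorem IsOrderUnit.nonneg_of_zsmul_nonneg (hu : IsOrderUnit u) {k : ℤ} (h : 0 ≤ k • u) :
    0 ≤ k := by
  by_contra! hk
  obtain ⟨n, rfl⟩ : ∃ n : ℕ, k = -((n + 1 : ℕ) : ℤ) := ⟨(-k - 1).toNat, by omega⟩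
  rw [neg_smul, natCast_zsmul, succ_nsmul, neg_add, ← sub_eq_add_neg, sub_nonneg] at h
  exact hu.1 (le_antisymm (h.trans (neg_nonpos.2 (nsmul_nonneg hu.2.1 n))) hu.2.1)

theorem IsOrderUnit.bddBelow_gauge (hu : IsOrderUnit u) (x : G) :
    BddBelow (Set.range fun q : {q : ℤ × ℕ // 0 < q.2 ∧ q.2 • x ≤ q.1 • u} =>
      (q.1.1 : ℝ) / q.1.2) := by
  obtain ⟨N, -, h1, -⟩ := hu.2.2 x
  refine ⟨-N, ?_⟩
  rintro _ ⟨⟨⟨k, m⟩, hm, h⟩, rfl⟩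
  dsimp only at hm h ⊢
  rw [le_div_iff₀ (by exact_mod_cast hm)]
  have h2 : m • (-(N • u)) ≤ k • u := (nsmul_le_nsmul_right h1 m).trans h
  have h3 : 0 ≤ (k + m * N : ℤ) • u := by
    rw [add_zsmul, mul_zsmul, natCast_zsmul, natCast_zsmul]
    rw [smul_neg] at h2
    exact neg_le_iff_add_nonneg'.1 h2 |>.trans_eq (add_comm _ _)
  have h4 : (0 : ℝ) ≤ k + m * N := by exact_mod_cast hu.nonneg_of_zsmul_nonneg h3
  linarith

theorem IsOrderUnit.gauge_le (hu : IsOrderUnit u) {x : G} {k : ℤ} {m : ℕ} (hm : 0 < m)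
    (h : m • x ≤ k • u) : gauge u x ≤ k / m :=
  ciInf_le (hu.bddBelow_gauge x) ⟨(k, m), hm, h⟩

theorem IsOrderUnit.isSublinear_gauge (hu : IsOrderUnit u) : IsSublinear (gauge u) where
  add_le x y := by
    have := hu.nonempty_gauge x
    have := hu.nonempty_gauge y
    refine le_ciInf_add_ciInf ?_
    rintro ⟨⟨k, m⟩, hm, h⟩ ⟨⟨l, n⟩, hn, h'⟩
    dsimp only at hm h hn h' ⊢
    have hm' : (m : ℝ) ≠ 0 := by positivity
    have hn' : (n : ℝ) ≠ 0 := by positivity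
    refine (hu.gauge_le (k := n * k + m * l) (m := m * n) (by positivity) ?_).trans_eq ?_
    · rw [nsmul_add, add_zsmul, mul_nsmul, mul_nsmul' y, mul_zsmul, mul_zsmul, natCast_zsmul,
        natCast_zsmul]
      exact add_le_add (nsmul_le_nsmul_right h n) (nsmul_le_nsmul_right h' m)
    · push_cast
      field_simp
  nsmul n x := by
    have := hu.nonempty_gauge x
    rcases Nat.eq_zero_or_pos n with rfl | hn
    · have := hu.nonempty_gauge 0
      rw [zero_nsmul, Nat.cast_zero, zero_mul]
      refine le_antisymm ?_ (le_ciInf ?_)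
      · simpa using hu.gauge_le (u := u) (x := 0) (k := 0) (m := 1) one_pos (by simp)
      · rintro ⟨⟨k, m⟩, hm, h⟩
        dsimp only at hm h ⊢
        have : (0 : ℝ) ≤ k := by
          exact_mod_cast hu.nonneg_of_zsmul_nonneg (by simpa using h)
        positivity
    have := hu.nonempty_gauge (n • x)
    have hn' : (n : ℝ) ≠ 0 := by positivity
    apply le_antisymm
    · unfold gauge
      rw [Real.mul_iInf_of_nonneg (Nat.cast_nonneg n)]
      refine le_ciInf ?_
      rintro ⟨⟨k, m⟩, hm, h⟩
      refine (hu.gauge_le (k := n * k) hm ?_).trans_eq ?_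
      · rw [← mul_nsmul', mul_comm, mul_nsmul', mul_zsmul, natCast_zsmul]
        exact nsmul_le_nsmul_right h n
      · push_cast
        ring
    · refine le_ciInf ?_
      rintro ⟨⟨k, m⟩, hm, h⟩
      dsimp only at hm h ⊢
      have hm' : (m : ℝ) ≠ 0 := by positivity
      have h2 := hu.gauge_le (x := x) (k := k) (m := m * n) (by positivity)
        (by rwa [mul_nsmul'])
      calc (n : ℝ) * gauge u x ≤ n * (k / (m * n : ℕ)) := by gcongr
        _ = k / m := by push_cast; field_simp

/-- In an unperforated group with order unit `u`, positivity is detected by strict positivity under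
the traces normalized at `u`. -/
theorem Unperforated.nonneg_of_traceSpace_pos (hG : Unperforated G) (hu : IsOrderUnit u) {g : G}
    (h : ∀ f ∈ traceSpace u, 0 < f g) : 0 ≤ g := by
  -- Any homomorphism below the gauge is a normalized trace; choosing one that attains the gauge at
  -- `-g` makes `gauge u (-g)` negative, so some `m • (-g) ≤ k • u` has `k ≤ 0`.
  obtain ⟨f, hf, hfg⟩ := hu.isSublinear_gauge.exists_addMonoidHom_le_apply_eq (-g)
  have hfu : f u = 1 := by
    have h1 := (hf u).trans (hu.gauge_le (k := 1) (m := 1) one_pos (by simp))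
    have h2 := (hf (-u)).trans (hu.gauge_le (k := -1) (m := 1) one_pos (by simp))
    norm_num at h1 h2
    linarith
  have hmem : f ∈ traceSpace u := by
    refine ⟨⟨?_, fun x hx => ?_⟩, hfu⟩
    · rintro rfl
      simp at hfu
    · have h1 := (hf (-x)).trans (hu.gauge_le (k := 0) (m := 1) one_pos (by simpa using hx))
      simpa using h1
  have hneg : gauge u (-g) < 0 := by
    rw [← hfg, map_neg]
    linarith [h f hmem]
  have := hu.nonempty_gauge (-g)
  obtain ⟨⟨⟨k, m⟩, hm, h1⟩, h2⟩ := exists_lt_of_ciInf_lt hneg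
  dsimp only at hm h1 h2
  refine hG g m hm ?_
  have hk : k ≤ 0 := by
    by_contra! hk
    have : (0 : ℝ) < k := by exact_mod_cast hk
    exact absurd h2 (not_lt.2 (by positivity))
  have h3 : k • u ≤ 0 := by
    have := zsmul_nonneg hu.2.1 (neg_nonneg.2 hk)
    rwa [neg_zsmul, neg_nonneg] at this
  rw [smul_neg] at h1
  exact neg_nonpos.1 (h1.trans h3)

end Gauge

/-! ### Compactness and convexity of the trace space -/

section TraceFunctions

variable {G : Type*} [AddCommGroup G] [PartialOrder G] {u : G}

theorem mem_traceFunctions_iff {f : G → ℝ} :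
    f ∈ traceFunctions u ↔
      (∀ x y, f (x + y) = f x + f y) ∧ (∀ g, 0 ≤ g → 0 ≤ f g) ∧ f u = 1 := by
  constructor
  · rintro ⟨f, ⟨⟨-, h1⟩, h2⟩, rfl⟩
    exact ⟨map_add f, h1, h2⟩
  · rintro ⟨h1, h2, h3⟩
    refine ⟨AddMonoidHom.mk' f h1, ⟨⟨fun h => ?_, h2⟩, h3⟩, rfl⟩
    have := DFunLike.congr_fun h u
    simp [h3] at this

theorem coe_mem_traceFunctions {f : G →+ ℝ} : ⇑f ∈ traceFunctions u ↔ f ∈ traceSpace u := by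
  constructor
  · rintro ⟨g, hg, h⟩
    rwa [← DFunLike.coe_injective h]
  · exact fun h => ⟨f, h, rfl⟩

theorem convex_traceFunctions : Convex ℝ (traceFunctions u) := by
  intro f hf g hg a b ha hb hab
  rw [mem_traceFunctions_iff] at *
  refine ⟨fun x y => ?_, fun x hx => ?_, ?_⟩
  · simp only [Pi.add_apply, Pi.smul_apply, smul_eq_mul, hf.1, hg.1]
    ring
  · have := hf.2.1 x hx
    have := hg.2.1 x hx
    simp only [Pi.add_apply, Pi.smul_apply, smul_eq_mul]
    positivity
  · simp [hf.2.2, hg.2.2, hab]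

variable [IsOrderedAddMonoid G]

theorem monotone_of_mem_traceSpace {f : G →+ ℝ} (hf : f ∈ traceSpace u) : Monotone f := by
  intro x y h
  have := hf.1.2 (y - x) (sub_nonneg.2 h)
  rw [map_sub] at this
  linarith

theorem isCompact_traceFunctions (hu : IsOrderUnit u) : IsCompact (traceFunctions u) := by
  choose N hN0 hN1 hN2 using hu.2.2
  have hK : IsCompact (Set.univ.pi fun g : G => Set.Icc (-(N g : ℝ)) (N g)) :=
    isCompact_univ_pi fun _ => isCompact_Icc
  refine hK.of_isClosed_subset ?_ ?_
  · have : traceFunctions u = (⋂ (x : G) (y : G), {f : G → ℝ | f (x + y) = f x + f y}) ∩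
        ((⋂ (g : G) (_ : 0 ≤ g), {f : G → ℝ | 0 ≤ f g}) ∩ {f : G → ℝ | f u = 1}) := by
      ext f
      simp [mem_traceFunctions_iff]
    rw [this]
    refine IsClosed.inter ?_ (IsClosed.inter ?_ ?_)
    · exact isClosed_iInter fun x => isClosed_iInter fun y =>
        isClosed_eq (by fun_prop) (by fun_prop)
    · exact isClosed_iInter fun x => isClosed_iInter fun _ =>
        isClosed_le (by fun_prop) (by fun_prop)
    · exact isClosed_eq (by fun_prop) (by fun_prop)
  · rintro _ ⟨f, hf, rfl⟩ g -
    have h1 := monotone_of_mem_traceSpace hf (hN1 g)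
    have h2 := monotone_of_mem_traceSpace hf (hN2 g)
    rw [map_neg, map_nsmul, hf.2] at h1
    rw [map_nsmul, hf.2] at h2
    exact ⟨by simpa using h1, by simpa using h2⟩

end TraceFunctions

/-! ### Extreme traces and the finite-dimensional simplex -/

section ExtremeTraces

universe w

variable {G : Type w} [AddCommGroup G] [PartialOrder G] {u : G}

theorem traceFunctions_apply_mono [IsOrderedAddMonoid G] {f : G → ℝ} (hf : f ∈ traceFunctions u)
    {x y : G} (h : x ≤ y) : f x ≤ f y := by
  obtain ⟨f, hf, rfl⟩ := hf
  exact monotone_of_mem_traceSpace hf h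

/-- A family of positive homomorphisms is separated if every positive element has, up to any
precision, a part on which one of them is concentrated and any finitely many others vanish. -/
def IsSeparated {ι : Type*} (T : ι → G → ℝ) : Prop :=
  ∀ (F : Finset ι) (i : ι), i ∉ F → ∀ b : G, 0 ≤ b → ∀ ε : ℝ, 0 < ε →
    ∃ x : G, 0 ≤ x ∧ x ≤ b ∧ T i (b - x) < ε ∧ ∀ j ∈ F, T j x < ε

/-- Evaluating a vanishing combination at a part of `u` where `T i` is almost `1` and the other
traces involved are almost `0` forces the coefficient of `T i` to vanish. -/
theorem IsSeparated.linearIndependent {ι : Type*} {T : ι → G → ℝ} (hT : IsSeparated T)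
    (hu : 0 ≤ u) (hmem : ∀ i, T i ∈ traceFunctions u) : LinearIndependent ℝ T := by
  classical
  rw [linearIndependent_iff']
  intro s c hc i hi
  by_contra hci
  set M := ∑ j ∈ s.erase i, |c j| with hM
  have hM0 : 0 ≤ M := Finset.sum_nonneg fun _ _ => abs_nonneg _
  have hci' : 0 < |c i| := abs_pos.2 hci
  have key : ∀ ε : ℝ, 0 < ε → |c i| ≤ ε * (M + |c i|) := fun ε hε => by
    obtain ⟨x, hx, -, h1, h2⟩ := hT (s.erase i) i (Finset.notMem_erase i s) u hu ε hε
    have h3 : T i (u - x) = 1 - T i x := by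
      obtain ⟨f, hf, hfi⟩ := hmem i
      rw [← hfi]
      simp [hf.2]
    have h4 : c i * T i x = -∑ j ∈ s.erase i, c j * T j x := by
      have := congrFun hc x
      rw [← Finset.add_sum_erase _ _ hi] at this
      simp only [Pi.add_apply, Pi.smul_apply, Finset.sum_apply, smul_eq_mul,
        Pi.zero_apply] at this
      linarith
    have hnn : ∀ j, 0 ≤ T j x := fun j => (mem_traceFunctions_iff.1 (hmem j)).2.1 x hx
    have h5 : |c i| * T i x ≤ M * ε := by
      calc |c i| * T i x = |c i * T i x| := by rw [abs_mul, abs_of_nonneg (hnn i)]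
        _ = |∑ j ∈ s.erase i, c j * T j x| := by rw [h4, abs_neg]
        _ ≤ ∑ j ∈ s.erase i, |c j * T j x| := Finset.abs_sum_le_sum_abs _ _
        _ ≤ ∑ j ∈ s.erase i, |c j| * ε := by
          refine Finset.sum_le_sum fun j hj => ?_
          rw [abs_mul, abs_of_nonneg (hnn j)]
          exact mul_le_mul_of_nonneg_left (h2 j hj).le (abs_nonneg _)
        _ = M * ε := by rw [hM, Finset.sum_mul]
    have h6 : |c i| * (1 - ε) ≤ |c i| * T i x :=
      mul_le_mul_of_nonneg_left (by linarith) hci'.le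
    linarith
  have h := key (|c i| / (2 * (M + |c i|))) (by positivity)
  have : |c i| / (2 * (M + |c i|)) * (M + |c i|) = |c i| / 2 := by
    field_simp
  linarith

variable [IsOrderedAddMonoid G]

theorem IsOrderUnit.exists_eq_sub (hu : IsOrderUnit u) (g : G) :
    ∃ a b : G, 0 ≤ a ∧ 0 ≤ b ∧ g = a - b := by
  obtain ⟨N, -, h, -⟩ := hu.2.2 g
  exact ⟨g + N • u, N • u, neg_le_iff_add_nonneg.1 h, nsmul_nonneg hu.2.1 N, by abel⟩

/-- A function that is additive on the positive cone extends to a homomorphism. -/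
theorem IsOrderUnit.exists_addMonoidHom_eq_on_nonneg (hu : IsOrderUnit u) {ρ : G → ℝ}
    (hρ : ∀ a b, 0 ≤ a → 0 ≤ b → ρ (a + b) = ρ a + ρ b) :
    ∃ F : G →+ ℝ, ∀ a, 0 ≤ a → F a = ρ a := by
  choose p q hp hq hpq using hu.exists_eq_sub
  have key : ∀ a b c d : G, 0 ≤ a → 0 ≤ b → 0 ≤ c → 0 ≤ d → a - b = c - d →
      ρ a - ρ b = ρ c - ρ d := fun a b c d ha hb hc hd h => by
    have h1 := hρ a d ha hd
    rw [sub_eq_sub_iff_add_eq_add.1 h, hρ c b hc hb] at h1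
    linarith
  refine ⟨AddMonoidHom.mk' (fun g => ρ (p g) - ρ (q g)) fun x y => ?_, fun a ha => ?_⟩
  · rw [key (p (x + y)) (q (x + y)) (p x + p y) (q x + q y) (hp _) (hq _)
      (add_nonneg (hp _) (hp _)) (add_nonneg (hq _) (hq _)), hρ _ _ (hp _) (hp _),
      hρ _ _ (hq _) (hq _)]
    · ring
    · rw [← hpq]
      nth_rewrite 1 [hpq x, hpq y]
      abel
  · have h0 := hρ 0 0 le_rfl le_rfl
    rw [add_zero] at h0
    have := key (p a) (q a) a 0 (hp a) (hq a) ha le_rfl (by rw [← hpq, sub_zero])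
    simp only [AddMonoidHom.mk'_apply]
    linarith

theorem IsOrderUnit.eq_zero_of_apply_eq_zero (hu : IsOrderUnit u) {F : G →+ ℝ}
    (hF : ∀ x, 0 ≤ x → 0 ≤ F x) (h : F u = 0) (x : G) : F x = 0 := by
  obtain ⟨N, -, h1, h2⟩ := hu.2.2 x
  have h3 := hF _ (sub_nonneg.2 h1)
  have h4 := hF _ (sub_nonneg.2 h2)
  simp only [map_sub, map_neg, map_nsmul, h, smul_zero] at h3 h4
  linarith

/-- A positive homomorphism dominated by an extreme trace is a multiple of it. -/
theorem IsOrderUnit.eq_smul_of_le_extreme (hu : IsOrderUnit u) {f : G → ℝ}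
    (hf : f ∈ (traceFunctions u).extremePoints ℝ) {F : G →+ ℝ} (hF0 : ∀ x, 0 ≤ x → 0 ≤ F x)
    (hF1 : ∀ x, 0 ≤ x → F x ≤ f x) (x : G) : F x = F u * f x := by
  rw [mem_extremePoints] at hf
  obtain ⟨hmem, hext⟩ := hf
  obtain ⟨f, hfS, rfl⟩ := hmem
  have hr0 : 0 ≤ F u := hF0 u hu.2.1
  have hr1 : F u ≤ 1 := by simpa [hfS.2] using hF1 u hu.2.1
  rcases hr0.eq_or_lt with hr | hr
  · rw [hu.eq_zero_of_apply_eq_zero hF0 hr.symm x, ← hr, zero_mul]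
  rcases hr1.eq_or_lt with hr' | hr'
  · have := hu.eq_zero_of_apply_eq_zero (F := f - F) (fun x hx => by simpa using hF1 x hx)
      (by simp [hfS.2, hr']) x
    rw [AddMonoidHom.sub_apply] at this
    rw [hr', one_mul]
    linarith
  · have hr'' : 0 < 1 - F u := sub_pos.2 hr'
    -- The trace `f` is the convex combination, with weights `F u` and `1 - F u`, of the
    -- normalizations of `F` and `f - F`.
    have h := (hext (fun y => (F u)⁻¹ * F y) ?_ (fun y => (1 - F u)⁻¹ * (f y - F y)) ?_
      ⟨F u, 1 - F u, hr, hr'', by ring, ?_⟩).1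
    · have h1 := congrFun h x
      dsimp only at h1 ⊢
      rw [← h1, mul_inv_cancel_left₀ hr.ne']
    · rw [mem_traceFunctions_iff]
      refine ⟨fun x y => by rw [map_add]; ring, fun g hg => ?_, inv_mul_cancel₀ hr.ne'⟩
      have := hF0 g hg
      positivity
    · rw [mem_traceFunctions_iff]
      refine ⟨fun x y => by rw [map_add, map_add]; ring, fun g hg => ?_, ?_⟩
      · have := sub_nonneg.2 (hF1 g hg)
        dsimp only at this
        positivity
      · rw [hfS.2, inv_mul_cancel₀ hr''.ne']
    · funext y
      simp only [Pi.add_apply, Pi.smul_apply, smul_eq_mul]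
      field_simp
      ring

/-- Distinct extreme traces are disjoint in the lattice of relatively bounded homomorphisms. -/
theorem RieszInterpolation.exists_lt_and_lt (hR : RieszInterpolation G) (hu : IsOrderUnit u)
    {f₁ f₂ : G → ℝ} (h₁ : f₁ ∈ (traceFunctions u).extremePoints ℝ)
    (h₂ : f₂ ∈ (traceFunctions u).extremePoints ℝ) (hne : f₁ ≠ f₂) {b : G} (hb : 0 ≤ b)
    {ε : ℝ} (hε : 0 < ε) : ∃ x : G, 0 ≤ x ∧ x ≤ b ∧ f₁ (b - x) < ε ∧ f₂ x < ε := by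
  obtain ⟨a₁, p₁, -⟩ := mem_traceFunctions_iff.1 h₁.1
  obtain ⟨a₂, p₂, -⟩ := mem_traceFunctions_iff.1 h₂.1
  -- This is the lattice infimum of `f₁` and `f₂` on the positive cone, additive by Riesz
  -- decomposition. As a multiple of both traces, it must vanish.
  set ρ : G → ℝ := fun b => ⨅ x : Set.Icc 0 b, (f₁ (b - x) + f₂ x) with hρ
  have hnonneg : ∀ (b : G) (x : Set.Icc 0 b), 0 ≤ f₁ (b - x) + f₂ x := fun b x =>
    add_nonneg (p₁ _ (sub_nonneg.2 x.2.2)) (p₂ _ x.2.1)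
  have hbdd : ∀ b : G, BddBelow (Set.range fun x : Set.Icc 0 b => f₁ (b - x) + f₂ x) :=
    fun b => ⟨0, by rintro _ ⟨x, rfl⟩; exact hnonneg b x⟩
  have hle : ∀ b x : G, 0 ≤ x → x ≤ b → ρ b ≤ f₁ (b - x) + f₂ x := fun b x hx hxb =>
    ciInf_le (hbdd b) ⟨x, hx, hxb⟩
  have hadd : ∀ a b, 0 ≤ a → 0 ≤ b → ρ (a + b) = ρ a + ρ b := fun a b ha hb => by
    have : Nonempty (Set.Icc 0 a) := ⟨⟨0, le_rfl, ha⟩⟩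
    have : Nonempty (Set.Icc 0 b) := ⟨⟨0, le_rfl, hb⟩⟩
    have : Nonempty (Set.Icc 0 (a + b)) := ⟨⟨0, le_rfl, add_nonneg ha hb⟩⟩
    apply le_antisymm
    · refine le_ciInf_add_ciInf fun x y => ?_
      refine (hle (a + b) (x + y) (add_nonneg x.2.1 y.2.1) (add_le_add x.2.2 y.2.2)).trans_eq ?_
      rw [show a + b - (x + y : G) = (a - x) + (b - y) by abel, a₁, a₂]
      ring
    · refine le_ciInf fun z => ?_
      obtain ⟨x, y, hxy, hx, hxa, hy, hyb⟩ := hR.exists_decomposition z.2.1 ha hb z.2.2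
      have h3 := hle a x hx hxa
      have h4 := hle b y hy hyb
      rw [← hxy, show a + b - (x + y : G) = (a - x) + (b - y) by abel, a₁, a₂]
      linarith
  obtain ⟨F, hF⟩ := hu.exists_addMonoidHom_eq_on_nonneg hadd
  have hF0 : ∀ x, 0 ≤ x → 0 ≤ F x := fun x hx => by
    rw [hF x hx]
    exact Real.iInf_nonneg (hnonneg x)
  have z₁ : f₁ 0 = 0 := by simpa using a₁ 0 0
  have z₂ : f₂ 0 = 0 := by simpa using a₂ 0 0
  have e₁ := hu.eq_smul_of_le_extreme h₁ hF0 fun x hx => by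
    rw [hF x hx]
    simpa [z₂] using hle x 0 le_rfl hx
  have e₂ := hu.eq_smul_of_le_extreme h₂ hF0 fun x hx => by
    rw [hF x hx]
    simpa [z₁] using hle x x hx le_rfl
  have hFu : F u = 0 := by
    by_contra h
    exact hne (funext fun x => mul_left_cancel₀ h ((e₁ x).symm.trans (e₂ x)))
  have hlt : ρ b < ε := by rwa [← hF b hb, e₁ b, hFu, zero_mul]
  have : Nonempty (Set.Icc 0 b) := ⟨⟨0, le_rfl, hb⟩⟩
  obtain ⟨⟨x, hx, hxb⟩, hlt⟩ := exists_lt_of_ciInf_lt hlt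
  have := p₁ _ (sub_nonneg.2 hxb)
  have := p₂ _ hx
  dsimp only at hlt
  exact ⟨x, hx, hxb, by linarith, by linarith⟩

/-- Pairwise disjointness is applied successively inside the part already found, halving the allowed
error at each stage. -/
theorem RieszInterpolation.isSeparated_extremePoints (hR : RieszInterpolation G)
    (hu : IsOrderUnit u) :
    IsSeparated ((↑) : (traceFunctions u).extremePoints ℝ → G → ℝ) := by
  classical
  intro F i
  induction F using Finset.induction_on with
  | empty =>
    intro _ b hb ε hε
    refine ⟨b, hb, le_rfl, ?_, by simp⟩
    have : (i : G → ℝ) 0 = 0 := by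
      simpa using (mem_traceFunctions_iff.1 i.2.1).1 0 0
    rwa [sub_self, this]
  | insert k F hk ih =>
    intro hi b hb ε hε
    rw [Finset.mem_insert, not_or] at hi
    obtain ⟨x, hx, hxb, h1, h2⟩ := ih hi.2 b hb (ε / 2) (half_pos hε)
    obtain ⟨y, hy, hyx, h3, h4⟩ := hR.exists_lt_and_lt hu i.2 k.2
      (fun h => hi.1 (Subtype.ext h)) hx (half_pos hε)
    refine ⟨y, hy, hyx.trans hxb, ?_, ?_⟩
    · rw [show b - y = (b - x) + (x - y) by abel, (mem_traceFunctions_iff.1 i.2.1).1]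
      linarith
    · intro j hj
      rcases Finset.mem_insert.1 hj with rfl | hj
      · linarith
      · have := traceFunctions_apply_mono j.2.1 hyx
        linarith [h2 j hj]

/-- Evaluation at a group element as a continuous affine function on the trace space. -/
noncomputable def affEval (u g : G) : Aff (traceFunctions u) :=
  ⟨⟨fun f => (f : G → ℝ) g, (continuous_apply g).comp continuous_subtype_val⟩, by
    intro x y z t _ _ h
    change (z : G → ℝ) g = _
    rw [h]
    rfl⟩

/-- Evaluations at extreme traces are independent in the finite-dimensional dual of `Aff`, since
restricting them to the functions `affEval u g` recovers the independent extreme traces. -/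
theorem RieszInterpolation.finite_extremePoints (hR : RieszInterpolation G)
    (hu : IsOrderUnit u) (hfin : FiniteDimensional ℝ (Aff (traceFunctions u))) :
    ((traceFunctions u).extremePoints ℝ).Finite := by
  have hli := (hR.isSeparated_extremePoints hu).linearIndependent hu.2.1 fun i => i.2.1
  let ev : (traceFunctions u).extremePoints ℝ → Module.Dual ℝ (Aff (traceFunctions u)) :=
    fun f =>
      { toFun := fun a => (a : C(traceFunctions u, ℝ)) ⟨f, f.2.1⟩
        map_add' := fun _ _ => rfl
        map_smul' := fun _ _ => rfl }
  let Φ : Module.Dual ℝ (Aff (traceFunctions u)) →ₗ[ℝ] G → ℝ :=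
    { toFun := fun φ g => φ (affEval u g)
      map_add' := fun _ _ => rfl
      map_smul' := fun _ _ => rfl }
  have hev : LinearIndependent ℝ ev := LinearIndependent.of_comp Φ hli
  exact hev.finite

theorem RieszInterpolation.convexHull_extremePoints (hR : RieszInterpolation G)
    (hu : IsOrderUnit u) (hfin : FiniteDimensional ℝ (Aff (traceFunctions u))) :
    convexHull ℝ ((traceFunctions u).extremePoints ℝ) = traceFunctions u := by
  have h := closure_convexHull_extremePoints (isCompact_traceFunctions hu)
    convex_traceFunctions
  rwa [((hR.finite_extremePoints hu hfin).isClosed_convexHull ℝ).closure_eq] at h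

/-- The trace space is a finite-dimensional simplex: it is spanned by finitely many separated
traces. -/
theorem RieszInterpolation.exists_fintype_isSeparated (hR : RieszInterpolation G)
    (hu : IsOrderUnit u) (hfin : FiniteDimensional ℝ (Aff (traceFunctions u))) :
    ∃ (ι : Type w) (_ : Fintype ι) (T : ι → G →+ ℝ), (∀ i, T i ∈ traceSpace u) ∧
      IsSeparated (fun i => ⇑(T i)) ∧
      ∀ σ ∈ traceSpace u, ∃ t ∈ stdSimplex ℝ ι, ∀ g, σ g = ∑ i, t i * T i g := by
  have hf := hR.finite_extremePoints hu hfin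
  let _ := hf.fintype
  choose T hT hTe using fun i : (traceFunctions u).extremePoints ℝ => i.2.1
  refine ⟨(traceFunctions u).extremePoints ℝ, hf.fintype, T, hT, ?_, fun σ hσ => ?_⟩
  · have := hR.isSeparated_extremePoints hu
    rwa [← funext hTe] at this
  · have h := coe_mem_traceFunctions.2 hσ
    rw [← hR.convexHull_extremePoints hu hfin, hf.convexHull_eq_image] at h
    obtain ⟨t, ht, hts⟩ := h
    refine ⟨t, ht, fun g => ?_⟩
    rw [← hts]
    simp only [← hTe]
    simp

end ExtremeTraces

/-! ### Subgroups of `ℝ ^ ι` with the splitting property -/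

section Lattice

variable {ι : Type*}

/-- A subgroup of `ℝ ^ ι` is conformally splitting if every element can be split inside the subgroup,
without cancellation, along every splitting of its negative part. -/
def IsConformallySplitting (L : AddSubgroup (ι → ℝ)) : Prop :=
  ∀ h ∈ L, ∀ a : ι → ℝ, (∀ i, 0 ≤ a i) → (∀ i, a i ≤ (h i)⁻) →
    ∃ k ∈ L, ∀ i, -a i ≤ k i ∧ k i ≤ (h i)⁺ - a i

/-- The elements of a subgroup with coordinates between `-p` and `q`. -/
def boxPart (L : AddSubgroup (ι → ℝ)) (p q : ℝ) : Set (ι → ℝ) :=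
  {h | h ∈ L ∧ ∀ i, -p ≤ h i ∧ h i ≤ q}

theorem span_boxPart_le_swap (L : AddSubgroup (ι → ℝ)) (p q : ℝ) :
    Submodule.span ℝ (boxPart L p q) ≤ Submodule.span ℝ (boxPart L q p) := by
  refine Submodule.span_le.2 fun h hh => ?_
  rw [SetLike.mem_coe, ← neg_mem_iff]
  refine Submodule.subset_span ⟨neg_mem hh.1, fun i => ?_⟩
  have := hh.2 i
  simp only [Pi.neg_apply]
  constructor <;> linarith

namespace IsConformallySplitting

variable {L : AddSubgroup (ι → ℝ)}

/-- Splitting along half of the negative part writes `h` as a sum of two elements, each with lower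
bound halved and upper bound preserved. -/
theorem span_boxPart_le_half (hL : IsConformallySplitting L) {p q : ℝ} (hp : 0 ≤ p)
    (hq : 0 ≤ q) :
    Submodule.span ℝ (boxPart L p q) ≤ Submodule.span ℝ (boxPart L (p / 2) q) := by
  refine Submodule.span_le.2 fun h hh => ?_
  obtain ⟨k, hk, hki⟩ := hL h hh.1 (fun i => (h i)⁻ / 2)
    (fun i => div_nonneg (negPart_nonneg _) zero_le_two)
    (fun i => half_le_self (negPart_nonneg _))
  have hneg : ∀ i, (h i)⁻ ≤ p := fun i => sup_le (by linarith [(hh.2 i).1]) hp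
  have hpos : ∀ i, (h i)⁺ ≤ q := fun i => sup_le (hh.2 i).2 hq
  have e : h = k + (h - k) := by abel
  rw [SetLike.mem_coe, e]
  refine add_mem (Submodule.subset_span ⟨hk, fun i => ?_⟩)
    (Submodule.subset_span ⟨sub_mem hh.1 hk, fun i => ?_⟩)
  · have h1 := hki i
    have := hneg i
    have := hpos i
    have := negPart_nonneg (h i)
    constructor <;> linarith
  · have h1 := hki i
    have := hneg i
    have := hpos i
    have := negPart_nonneg (h i)
    have := posPart_sub_negPart (h i)
    simp only [Pi.sub_apply]
    constructor <;> linarith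

theorem span_boxPart_le (hL : IsConformallySplitting L) {r : ℝ} (hr : 0 ≤ r) (n : ℕ) :
    Submodule.span ℝ (boxPart L r r) ≤
      Submodule.span ℝ (boxPart L (r / 2 ^ n) (r / 2 ^ n)) := by
  induction n with
  | zero => simp
  | succ n ih =>
    have h1 : 0 ≤ r / 2 ^ n := by positivity
    have h2 : r / 2 ^ (n + 1) = r / 2 ^ n / 2 := by rw [pow_succ, div_div]
    rw [h2]
    exact ih.trans ((hL.span_boxPart_le_half h1 h1).trans ((span_boxPart_le_swap _ _ _).trans
      (hL.span_boxPart_le_half h1 (by positivity))))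

end IsConformallySplitting

variable [Fintype ι]

/-- A subgroup containing arbitrarily small spanning sets of a subspace is dense in it. -/
theorem mem_closure_of_forall_mem_span {L : AddSubgroup (ι → ℝ)} {x : ι → ℝ}
    (h : ∀ δ : ℝ, 0 < δ → x ∈ Submodule.span ℝ {y | y ∈ L ∧ ‖y‖ < δ}) :
    x ∈ closure (L : Set (ι → ℝ)) := by
  rw [Metric.mem_closure_iff]
  intro ε hε
  set n := Module.finrank ℝ (ι → ℝ)
  set δ := ε / (n + 1) with hδ
  have hδ0 : 0 < δ := by positivity
  obtain ⟨b, hbs, hspan, hli⟩ := exists_linearIndependent ℝ {y | y ∈ L ∧ ‖y‖ < δ}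
  have hx := h δ hδ0
  have hb : b.Finite := hli.setFinite
  lift b to Finset (ι → ℝ) using hb
  rw [← hspan, Submodule.mem_span_finset] at hx
  obtain ⟨c, -, rfl⟩ := hx
  have hcard : b.card ≤ n := LinearIndependent.finset_card_le_finrank hli
  -- Rounding the coefficients down costs at most `δ` per vector, and an independent set has at most
  -- `n` vectors.
  refine ⟨∑ v ∈ b, ⌊c v⌋ • v, sum_mem fun v hv => zsmul_mem (hbs hv).1 _, ?_⟩
  rw [dist_eq_norm, ← Finset.sum_sub_distrib]
  calc ‖∑ v ∈ b, (c v • v - ⌊c v⌋ • v)‖ ≤ ∑ v ∈ b, ‖c v • v - ⌊c v⌋ • v‖ := norm_sum_le _ _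
    _ ≤ ∑ v ∈ b, δ := by
      refine Finset.sum_le_sum fun v hv => ?_
      rw [← Int.cast_smul_eq_zsmul ℝ, ← sub_smul, norm_smul, Int.self_sub_floor, Real.norm_eq_abs,
        abs_of_nonneg (Int.fract_nonneg _)]
      calc Int.fract (c v) * ‖v‖ ≤ 1 * δ :=
            mul_le_mul (Int.fract_lt_one _).le (hbs hv).2.le (norm_nonneg _) zero_le_one
        _ = δ := one_mul δ
    _ = b.card * δ := by rw [Finset.sum_const, nsmul_eq_mul]
    _ ≤ n * δ := by gcongr
    _ < (n + 1) * δ := by linarith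
    _ = ε := by rw [hδ]; field_simp

namespace IsConformallySplitting

variable {L : AddSubgroup (ι → ℝ)}

theorem mem_span_small (hL : IsConformallySplitting L) {h : ι → ℝ} (hh : h ∈ L) {δ : ℝ}
    (hδ : 0 < δ) : h ∈ Submodule.span ℝ {y | y ∈ L ∧ ‖y‖ < δ} := by
  obtain ⟨n, hn⟩ := exists_pow_lt_of_lt_one (y := (1 / 2 : ℝ))
    (show 0 < δ / (‖h‖ + 1) by positivity) (by norm_num)
  have hsmall : ‖h‖ / 2 ^ n < δ := by
    rw [lt_div_iff₀ (by positivity), one_div, inv_pow] at hn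
    rw [div_eq_inv_mul]
    refine lt_of_le_of_lt ?_ hn
    gcongr
    linarith
  have h1 : h ∈ boxPart L ‖h‖ ‖h‖ := ⟨hh, fun i => abs_le.1 (norm_le_pi_norm h i)⟩
  refine Submodule.span_mono ?_ (hL.span_boxPart_le (norm_nonneg h) n (Submodule.subset_span h1))
  rintro y ⟨hy, hyi⟩
  exact ⟨hy, ((pi_norm_le_iff_of_nonneg (by positivity)).2 fun i => abs_le.2 (hyi i)).trans_lt
    hsmall⟩

/-- The annihilator of a conformally splitting subgroup is a sublattice. -/
theorem sum_posPart_mul_eq_zero (hL : IsConformallySplitting L) {φ : ι → ℝ}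
    (hφ : ∀ h ∈ L, ∑ i, φ i * h i = 0) {h : ι → ℝ} (hh : h ∈ L) :
    ∑ i, (φ i)⁺ * h i = 0 := by
  have key : ∀ h ∈ L, 0 ≤ ∑ i, (φ i)⁺ * h i := fun h hh => by
    classical
    -- With this choice `k ≤ h` where `φ > 0` and `k ≥ 0` elsewhere, so `φ(k) = 0` is at most the
    -- pairing of the positive part of `φ` with `h`.
    obtain ⟨k, hk, hki⟩ := hL h hh (fun i => if 0 < φ i then (h i)⁻ else 0)
      (fun i => by split_ifs; exacts [negPart_nonneg _, le_rfl])
      (fun i => by split_ifs; exacts [le_rfl, negPart_nonneg _])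
    rw [← hφ k hk]
    refine Finset.sum_le_sum fun i _ => ?_
    have h1 := hki i
    split_ifs at h1 with hi
    · rw [posPart_sub_negPart] at h1
      rw [posPart_of_nonneg hi.le]
      exact mul_le_mul_of_nonneg_left h1.2 hi.le
    · rw [posPart_of_nonpos (not_lt.1 hi), zero_mul]
      exact mul_nonpos_of_nonpos_of_nonneg (not_lt.1 hi) (by simpa using h1.1)
  refine le_antisymm ?_ (key h hh)
  have := key (-h) (neg_mem hh)
  simp only [Pi.neg_apply, mul_neg, Finset.sum_neg_distrib] at this
  linarith

/-- A conformally splitting subgroup annihilated by a single probability vector is dense in the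
hyperplane defined by that vector. -/
theorem mem_closure (hL : IsConformallySplitting L) {t : ι → ℝ}
    (ht : ∀ s ∈ stdSimplex ℝ ι, (∀ h ∈ L, ∑ i, s i * h i = 0) → s = t) {x : ι → ℝ}
    (hx : ∑ i, t i * x i = 0) : x ∈ closure (L : Set (ι → ℝ)) := by
  classical
  have key : ∀ s : ι → ℝ, (∀ i, 0 ≤ s i) → (∀ h ∈ L, ∑ i, s i * h i = 0) →
      ∑ i, s i * x i = 0 := fun s hs0 hsL => by
    rcases (Finset.sum_nonneg fun i _ => hs0 i).eq_or_lt with h | h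
    · refine Finset.sum_eq_zero fun i hi => ?_
      rw [(Finset.sum_eq_zero_iff_of_nonneg fun i _ => hs0 i).1 h.symm i hi, zero_mul]
    · have hst := ht (fun i => (∑ j, s j)⁻¹ * s i)
        ⟨fun i => mul_nonneg (inv_nonneg.2 h.le) (hs0 i), by
          rw [← Finset.mul_sum, inv_mul_cancel₀ h.ne']⟩ fun y hy => by
          simp only [mul_assoc, ← Finset.mul_sum, hsL y hy, mul_zero]
      rw [← hst] at hx
      simp only [mul_assoc, ← Finset.mul_sum] at hx
      exact (mul_eq_zero.1 hx).resolve_left (inv_ne_zero h.ne')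
  refine mem_closure_of_forall_mem_span fun δ hδ => ?_
  by_contra hxs
  obtain ⟨f, hfx, hf⟩ := Submodule.exists_le_ker_of_notMem hxs
  have hfe : ∀ y, f y = ∑ i, f (Pi.single i 1) * y i := fun y => by
    conv_lhs => rw [pi_eq_sum_univ' y]
    simp [mul_comm]
  have hfL : ∀ h ∈ L, ∑ i, f (Pi.single i 1) * h i = 0 := fun h hh => by
    rw [← hfe]
    exact hf (hL.mem_span_small hh hδ)
  -- Both the positive and the negative part of the separating functional annihilate `L`, so both
  -- vanish at `x`.
  have h1 := key _ (fun i => posPart_nonneg _) fun h hh => hL.sum_posPart_mul_eq_zero hfL hh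
  have h2 := key _ (fun i => posPart_nonneg _) fun h hh =>
    hL.sum_posPart_mul_eq_zero (φ := fun i => -f (Pi.single i 1))
      (fun h hh => by simp [hfL h hh]) hh
  refine hfx ?_
  rw [hfe, ← sub_eq_zero.2 (h1.trans h2.symm), ← Finset.sum_sub_distrib]
  refine Finset.sum_congr rfl fun i _ => ?_
  rw [posPart_neg, ← sub_mul, posPart_sub_negPart]

end IsConformallySplitting

end Lattice

/-! ### Coordinates given by the extreme traces -/

section Coordinates

variable {G : Type*} [AddCommGroup G] [PartialOrder G] {u : G}
  {ι : Type*} [Fintype ι]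

theorem Simple.traceSpace_pos [IsOrderedAddMonoid G] (hG : Simple G) {f : G →+ ℝ}
    (hf : f ∈ traceSpace u) {g : G}
    (h0 : 0 ≤ g) (h1 : g ≠ 0) : 0 < f g := by
  obtain ⟨N, -, -, h⟩ := (hG.isOrderUnit h0 h1).2.2 u
  have h2 := monotone_of_mem_traceSpace hf h
  rw [hf.2, map_nsmul, nsmul_eq_mul] at h2
  by_contra! h3
  have := mul_nonpos_of_nonneg_of_nonpos (Nat.cast_nonneg (α := ℝ) N) h3
  linarith

/-- The image of a group with arbitrarily small positive elements under a finite separated family of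
normalized traces is dense. -/
theorem Simple.dense_range_of_isSeparated [IsOrderedAddMonoid G] (hG : Simple G)
    (hu : IsOrderUnit u)
    (hsmall : ∀ b : G, 0 ≤ b → b ≠ 0 → ∃ d : G, 0 ≤ d ∧ d ≠ 0 ∧ 2 • d ≤ b)
    {T : ι → G →+ ℝ} (hT : ∀ i, T i ∈ traceSpace u) (hsep : IsSeparated fun i => ⇑(T i)) :
    Dense (Set.range fun g i => T i g) := by
  classical
  set R : AddSubgroup (ι → ℝ) := (AddMonoidHom.pi T).range with hR
  have hRset : (R : Set (ι → ℝ)) = Set.range fun g i => T i g := rfl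
  have hsingle : ∀ (d : G) (i : ι), 0 ≤ d → Pi.single i (T i d) ∈ R.topologicalClosure := by
    intro d i hd
    rw [← SetLike.mem_coe, AddSubgroup.topologicalClosure_coe, Metric.mem_closure_iff]
    intro ε hε
    obtain ⟨x, hx, hxd, h1, h2⟩ := hsep (Finset.univ.erase i) i (Finset.notMem_erase _ _) d hd ε hε
    refine ⟨fun j => T j x, ⟨x, rfl⟩, (dist_pi_lt_iff hε).2 fun j => ?_⟩
    rw [Real.dist_eq]
    by_cases hj : j = i
    · subst hj
      rw [Pi.single_eq_same, ← map_sub, abs_of_nonneg ((hT j).1.2 _ (sub_nonneg.2 hxd))]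
      exact h1
    · rw [Pi.single_eq_of_ne hj, zero_sub, abs_neg, abs_of_nonneg ((hT j).1.2 _ hx)]
      exact h2 j (Finset.mem_erase.2 ⟨hj, Finset.mem_univ j⟩)
  intro x
  rw [← hRset]
  have hclosed : closure (R.topologicalClosure : Set (ι → ℝ)) = closure (R : Set (ι → ℝ)) := by
    rw [AddSubgroup.topologicalClosure_coe, closure_closure]
  rw [← hclosed]
  refine mem_closure_of_forall_mem_span fun δ hδ => ?_
  obtain ⟨n, hn⟩ := exists_pow_lt_of_lt_one hδ (show (1 / 2 : ℝ) < 1 by norm_num)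
  obtain ⟨d, hd, hd0, hdu⟩ := exists_two_pow_nsmul_le hsmall hu.2.1 hu.1 n
  have hTd : ∀ i, T i d < δ := fun i => by
    have h1 := monotone_of_mem_traceSpace (hT i) hdu
    rw [(hT i).2, map_nsmul, nsmul_eq_mul] at h1
    refine lt_of_le_of_lt ?_ hn
    rw [one_div, inv_pow, ← one_div, le_div_iff₀ (by positivity)]
    push_cast at h1
    linarith
  rw [pi_eq_sum_univ' x]
  refine sum_mem fun i _ => Submodule.smul_mem _ _ ?_
  have hpos := hG.traceSpace_pos (hT i) hd hd0
  have e : Pi.single (M := fun _ => ℝ) i 1 = (T i d)⁻¹ • Pi.single i (T i d) := by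
    rw [← Pi.single_smul, smul_eq_mul, inv_mul_cancel₀ hpos.ne']
  rw [e]
  refine Submodule.smul_mem _ _ (Submodule.subset_span ⟨hsingle d i hd, ?_⟩)
  rw [Pi.norm_single, Real.norm_eq_abs, abs_of_pos hpos]
  exact hTd i

/-- Approximate splittings lie in a compact box, so a subsequence converges to an exact one. -/
theorem isConformallySplitting_of_approx {L : AddSubgroup (ι → ℝ)}
    (hclosed : IsClosed (L : Set (ι → ℝ)))
    (h : ∀ h ∈ L, ∀ a : ι → ℝ, (∀ i, 0 ≤ a i) → (∀ i, a i ≤ (h i)⁻) → ∀ ε : ℝ, 0 < ε →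
      ∃ k ∈ L, ∀ i, -a i - ε ≤ k i ∧ k i ≤ (h i)⁺ - a i + ε) :
    IsConformallySplitting L := by
  intro y hy a ha0 ha1
  choose k hkL hk using fun n : ℕ => h y hy a ha0 ha1 (1 / ((n : ℝ) + 1)) Nat.one_div_pos_of_nat
  have hmem : ∀ n, k n ∈ Set.Icc (fun i => -a i - 1) (fun i => (y i)⁺ - a i + 1) := fun n => by
    have h1 : 1 / ((n : ℝ) + 1) ≤ 1 := by
      rw [div_le_one (by positivity)]
      linarith [Nat.cast_nonneg (α := ℝ) n]
    exact ⟨fun i => by linarith [(hk n i).1], fun i => by linarith [(hk n i).2]⟩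
  obtain ⟨l, -, φ, hφ, hl⟩ := isCompact_Icc.tendsto_subseq hmem
  have hε : Filter.Tendsto (fun n => 1 / ((φ n : ℝ) + 1)) Filter.atTop (nhds 0) :=
    tendsto_one_div_add_atTop_nhds_zero_nat.comp hφ.tendsto_atTop
  rw [tendsto_pi_nhds] at hl
  refine ⟨l, hclosed.mem_of_tendsto (tendsto_pi_nhds.2 hl) (Filter.Eventually.of_forall
    fun n => hkL (φ n)), fun i => ⟨?_, ?_⟩⟩
  · have := le_of_tendsto_of_tendsto' (tendsto_const_nhds.sub hε) (hl i)
      fun n => (hk (φ n) i).1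
    rwa [sub_zero] at this
  · refine (le_of_tendsto_of_tendsto' (hl i) (tendsto_const_nhds.add hε)
      fun n => (hk (φ n) i).2).trans_eq (add_zero _)

theorem IsRefinableTrace.isConformallySplitting {τ : G →+ ℝ} (hτ : IsRefinableTrace τ)
    {T : ι → G →+ ℝ} (hT : ∀ i, T i ∈ traceSpace u)
    (hpos : ∀ g, (∀ i, 0 < T i g) → 0 ≤ g) (hdense : Dense (Set.range fun g i => T i g)) :
    IsConformallySplitting (τ.ker.map (AddMonoidHom.pi T)).topologicalClosure := by
  set L := τ.ker.map (AddMonoidHom.pi T) with hL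
  have happrox : ∀ (y : ι → ℝ) (η : ℝ), 0 < η → ∃ g, ∀ i, |y i - T i g| < η := fun y η hη => by
    obtain ⟨_, ⟨g, rfl⟩, hg⟩ := hdense.exists_dist_lt y hη
    exact ⟨g, fun i => (dist_pi_lt_iff hη).1 hg i⟩
  refine isConformallySplitting_of_approx L.isClosed_topologicalClosure ?_
  intro h hh a ha0 ha1 ε hε
  obtain ⟨η, hη, hηε⟩ : ∃ η : ℝ, 0 < η ∧ 4 * η = ε := ⟨ε / 4, by positivity, by ring⟩
  rw [← SetLike.mem_coe, AddSubgroup.topologicalClosure_coe, Metric.mem_closure_iff] at hh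
  obtain ⟨_, ⟨g, hg, rfl⟩, hgh⟩ := hh η hη
  -- The margins `2 * η` keep `g₁`, `g₂` and `g₁ + g₂ + g` positive despite three errors of size
  -- `η`. Refining the last element into `c₁ + c₂` gives the splitting `c₁ - g₁`, with total error
  -- at most `4 * η`.
  obtain ⟨g₁, hg₁⟩ := happrox (fun i => a i + 2 * η) η hη
  obtain ⟨g₂, hg₂⟩ := happrox (fun i => (h i)⁻ - a i + 2 * η) η hη
  have b : ∀ i, |h i - T i g| < η := fun i => (dist_pi_lt_iff hη).1 hgh i
  simp only [abs_lt] at hg₁ hg₂ b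
  have hsub := fun i => posPart_sub_negPart (h i)
  have p₁ : 0 ≤ g₁ := hpos _ fun i => by linarith [hg₁ i, ha0 i]
  have p₂ : 0 ≤ g₂ := hpos _ fun i => by linarith [hg₂ i, ha1 i]
  have p₃ : 0 ≤ g₁ + g₂ + g := hpos _ fun i => by
    rw [map_add, map_add]
    linarith [hg₁ i, hg₂ i, b i, hsub i, posPart_nonneg (h i)]
  have hτg : τ g = 0 := hg
  obtain ⟨c₁, c₂, hc₁, hc₂, hc, hcτ⟩ := hτ g₁ g₂ _ p₁ p₂ p₃ fun σ hσ => by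
    rw [Set.mem_singleton_iff.1 hσ]
    simp [hτg]
  refine ⟨fun i => T i (c₁ - g₁), L.le_topologicalClosure ⟨c₁ - g₁, ?_, rfl⟩, fun i => ?_⟩
  · have := (hcτ τ rfl).1
    simp [AddMonoidHom.mem_ker, this]
  · have h1 := (hT i).1.2 c₁ hc₁
    have h2 := (hT i).1.2 c₂ hc₂
    have h3 := congrArg (T i) hc
    simp only [map_add] at h3
    simp only [map_sub]
    constructor <;> linarith [hg₁ i, hg₂ i, b i, hsub i]

end Coordinates

/-! ### Good traces and the two implications -/

section Good

variable {G : Type*} [AddCommGroup G] [PartialOrder G] {u : G}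

theorem isGoodTrace_iff {τ : G →+ ℝ} :
    IsGoodTrace τ ↔ ∀ a b : G, 0 ≤ b → b ≠ 0 → 0 < τ a → τ a < τ b →
      ∃ a' : G, 0 ≤ a' ∧ a' ≠ 0 ∧ a' < b ∧ τ a' = τ a := by
  simp [IsGoodTrace, Good]

theorem IsGoodTrace.isRefinableTrace [IsOrderedAddMonoid G] (hG : Simple G) {τ : G →+ ℝ}
    (hτ : τ ∈ traceSpace u) (h : IsGoodTrace τ) : IsRefinableTrace τ := by
  intro a₁ a₂ b h₁ h₂ hb hab
  simp only [Set.mem_singleton_iff, forall_eq] at hab ⊢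
  by_cases ha₁ : a₁ = 0
  · subst ha₁
    exact ⟨0, b, le_rfl, hb, zero_add b, rfl, by rw [← hab, map_zero, zero_add]⟩
  by_cases ha₂ : a₂ = 0
  · subst ha₂
    exact ⟨b, 0, hb, le_rfl, add_zero b, by rw [← hab, map_zero, add_zero], rfl⟩
  have p₁ := hG.traceSpace_pos hτ h₁ ha₁
  have p₂ := hG.traceSpace_pos hτ h₂ ha₂
  have hb0 : b ≠ 0 := by
    rintro rfl
    rw [map_zero] at hab
    linarith
  obtain ⟨a', h0, -, hlt, he⟩ := isGoodTrace_iff.1 h a₁ b hb hb0 p₁ (by linarith)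
  refine ⟨a', b - a', h0, sub_nonneg.2 hlt.le, by abel, he, ?_⟩
  rw [map_sub]
  linarith

theorem IsGoodTrace.annihilatingTraces_ker (hu : IsOrderUnit u) [IsOrderedAddMonoid G]
    {τ : G →+ ℝ} (hτ : τ ∈ traceSpace u) (h : IsGoodTrace τ) :
    annihilatingTraces u τ.ker = {τ} := by
  refine Set.eq_singleton_iff_unique_mem.2 ⟨⟨hτ, fun _ h => h⟩, ?_⟩
  rintro σ ⟨hσ, hker⟩
  have hpos : ∀ g, 0 < τ g → 0 ≤ σ g := fun g hg => by
    obtain ⟨n, hn⟩ := exists_nat_gt (τ g)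
    have hn0 : n • u ≠ 0 := fun h0 => by
      have : τ (n • u) = n := by rw [map_nsmul, hτ.2, nsmul_eq_mul, mul_one]
      rw [h0, map_zero] at this
      linarith
    obtain ⟨a', h0, -, -, he⟩ := isGoodTrace_iff.1 h g (n • u) (nsmul_nonneg hu.2.1 n) hn0 hg
      (by rw [map_nsmul, hτ.2, nsmul_eq_mul, mul_one]; exact hn)
    have := hker (g - a') (by simp [AddMonoidHom.mem_ker, he])
    rw [map_sub, sub_eq_zero] at this
    rw [this]
    exact hσ.1.2 a' h0
  have hle : ∀ g, τ g ≤ σ g := fun g => by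
    by_contra! hlt
    obtain ⟨q, hq1, hq2⟩ := exists_rat_btwn hlt
    have hd : (0 : ℝ) < q.den := by exact_mod_cast q.den_pos
    rw [Rat.cast_def, lt_div_iff₀ hd] at hq1
    rw [Rat.cast_def, div_lt_iff₀ hd] at hq2
    have := hpos (q.den • g - q.num • u) (by
      rw [map_sub, map_nsmul, map_zsmul, hτ.2, nsmul_eq_mul, zsmul_eq_mul]
      linarith)
    rw [map_sub, map_nsmul, map_zsmul, hσ.2, nsmul_eq_mul, zsmul_eq_mul] at this
    linarith
  ext g
  have := hle (-g)
  rw [map_neg, map_neg] at this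
  exact le_antisymm (by linarith) (hle g)

theorem isGoodTrace_of_mem_zmultiples [IsOrderedAddMonoid G] {v : G} (hv : 0 ≤ v)
    (h : ∀ g, g ∈ AddSubgroup.zmultiples v) {τ : G →+ ℝ} (hτ : τ ∈ traceSpace u) :
    IsGoodTrace τ := by
  have key : ∀ g, 0 < τ g → 0 ≤ g := fun g hg => by
    obtain ⟨k, rfl⟩ := h g
    simp only [map_zsmul, zsmul_eq_mul] at hg
    have : (0 : ℝ) ≤ k := by
      by_contra! hk
      exact absurd hg (not_lt.2 (mul_nonpos_of_nonpos_of_nonneg hk.le (hτ.1.2 v hv)))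
    exact zsmul_nonneg hv (by exact_mod_cast this)
  refine isGoodTrace_iff.2 fun a b _ _ h0 h1 => ⟨a, key a h0, ?_, lt_of_le_of_ne ?_ ?_, rfl⟩
  · rintro rfl
    simp at h0
  · exact sub_nonneg.1 (key _ (by rw [map_sub]; linarith))
  · rintro rfl
    exact lt_irrefl _ h1

theorem IsRefinableTrace.isGoodTrace [IsOrderedAddMonoid G] (hu : IsOrderUnit u)
    (hsimple : Simple G) (hdim : DimensionGroup G)
    (hfin : FiniteDimensional ℝ (Aff (traceFunctions u))) {τ : G →+ ℝ} (hτ : τ ∈ traceSpace u)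
    (href : IsRefinableTrace τ) (hZ : annihilatingTraces u τ.ker = {τ}) : IsGoodTrace τ := by
  obtain ⟨-, hunperf, hR⟩ := hdim
  rcases hsimple.cyclic_or_exists_two_nsmul_le hR with ⟨v, hv, hgen⟩ | hsmall
  -- The cyclic case is separate because the density argument needs small positive elements.
  · exact isGoodTrace_of_mem_zmultiples hv hgen hτ
  obtain ⟨ι, _, T, hT, hsep, hcomb⟩ := hR.exists_fintype_isSeparated hu hfin
  have hpos : ∀ g, (∀ i, 0 < T i g) → 0 ≤ g := fun g hg => by
    refine hunperf.nonneg_of_traceSpace_pos hu fun σ hσ => ?_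
    obtain ⟨s, hs, hσs⟩ := hcomb σ hσ
    rw [hσs]
    obtain ⟨i, -, hi⟩ : ∃ i ∈ Finset.univ, 0 < s i :=
      Finset.exists_lt_of_sum_lt (by simp [hs.2])
    exact Finset.sum_pos' (fun j _ => mul_nonneg (hs.1 j) (hg j).le)
      ⟨i, Finset.mem_univ i, mul_pos hi (hg i)⟩
  have hdense := hsimple.dense_range_of_isSeparated hu hsmall hT hsep
  have hsplit := href.isConformallySplitting hT hpos hdense
  obtain ⟨t, ht, hτt⟩ := hcomb τ hτ
  have hli := hsep.linearIndependent hu.2.1 fun i => coe_mem_traceFunctions.2 (hT i)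
  have hunique : ∀ s ∈ stdSimplex ℝ ι,
      (∀ h ∈ (τ.ker.map (AddMonoidHom.pi T)).topologicalClosure, ∑ i, s i * h i = 0) →
        s = t := fun s hs hsL => by
    obtain ⟨σ, hσ, hσs⟩ : (fun g => ∑ i, s i * T i g) ∈ traceFunctions u := by
      rw [mem_traceFunctions_iff]
      refine ⟨fun x y => ?_, fun g hg => ?_, ?_⟩
      · simp only [map_add, mul_add, Finset.sum_add_distrib]
      · exact Finset.sum_nonneg fun i _ => mul_nonneg (hs.1 i) ((hT i).1.2 g hg)
      · simp only [(hT _).2, mul_one, hs.2]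
    have hmem : σ ∈ annihilatingTraces u τ.ker := ⟨hσ, fun g hg => by
      have h1 := congrFun hσs g
      dsimp only at h1
      rw [h1]
      exact hsL (fun i => T i g) (AddSubgroup.le_topologicalClosure _ ⟨g, hg, rfl⟩)⟩
    rw [hZ, Set.mem_singleton_iff] at hmem
    subst hmem
    rw [Fintype.linearIndependent_iff] at hli
    funext i
    refine sub_eq_zero.1 (hli (fun i => s i - t i) ?_ i)
    funext g
    have h1 := congrFun hσs g
    dsimp only at h1
    rw [hτt] at h1
    simp [sub_mul, Finset.sum_sub_distrib, h1]
  refine isGoodTrace_iff.2 fun a b hb hb0 h0 h1 => ?_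
  have hTb := fun i => hsimple.traceSpace_pos (hT i) hb hb0
  have hτb : 0 < τ b := h0.trans h1
  set r := τ a / τ b with hr
  have hr0 : 0 < r := by positivity
  have hr1 : r < 1 := (div_lt_one hτb).2 h1
  obtain ⟨ε, hε, hεb⟩ : ∃ ε : ℝ, 0 < ε ∧ ∀ i, ε < r * T i b ∧ ε < (1 - r) * T i b := by
    have h2 : ∀ᶠ ε : ℝ in nhdsWithin 0 (Set.Ioi 0),
        ∀ i, ε < r * T i b ∧ ε < (1 - r) * T i b := by
      rw [Filter.eventually_all]
      intro i
      exact nhdsWithin_le_nhds ((eventually_lt_nhds (mul_pos hr0 (hTb i))).and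
        (eventually_lt_nhds (mul_pos (sub_pos.2 hr1) (hTb i))))
    exact (h2.and self_mem_nhdsWithin).exists.imp fun ε h => ⟨h.2, h.1⟩
  -- The vector from the coordinates of `a` to `r` times those of `b` lies in the hyperplane of `τ`,
  -- hence is approximated by `ker τ`.
  have hx := hsplit.mem_closure hunique (x := fun i => r * T i b - T i a) (by
    simp only [mul_sub, Finset.sum_sub_distrib, mul_left_comm _ r, ← Finset.mul_sum, ← hτt]
    rw [hr, div_mul_cancel₀ _ hτb.ne', sub_self])
  rw [AddSubgroup.topologicalClosure_coe, closure_closure, Metric.mem_closure_iff] at hx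
  obtain ⟨_, ⟨g, hg, rfl⟩, hgx⟩ := hx ε hε
  have hgi : ∀ i, |r * T i b - T i a - T i g| < ε := fun i => (dist_pi_lt_iff hε).1 hgx i
  simp only [abs_lt] at hgi
  have hτg : τ (a + g) = τ a := by
    rw [map_add, show τ g = 0 from hg, add_zero]
  refine ⟨a + g, hpos _ fun i => ?_, ?_, lt_of_le_of_ne (sub_nonneg.1 (hpos _ fun i => ?_)) ?_,
    hτg⟩
  · rw [map_add]
    linarith [hgi i, hεb i]
  · intro h
    rw [h, map_zero] at hτg
    linarith
  · rw [map_sub, map_add]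
    linarith [hgi i, hεb i]
  · intro h
    rw [h] at hτg
    linarith

end Good

end POGroup

theorem corollary8p2 {G : Type*} [AddCommGroup G] [PartialOrder G] [IsOrderedAddMonoid G]
    (u : G) (hu : POGroup.IsOrderUnit u)
    (hsimple : POGroup.Simple G) (hdim : POGroup.DimensionGroup G)
    (hfin : FiniteDimensional ℝ (POGroup.Aff (POGroup.traceFunctions u)))
    (τ : G →+ ℝ) (hτ : τ ∈ POGroup.traceSpace u) :
    POGroup.IsGoodTrace τ ↔
      (POGroup.IsRefinableTrace τ ∧ POGroup.annihilatingTraces u τ.ker = {τ}) :=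
  ⟨fun h => ⟨h.isRefinableTrace hsimple hτ, h.annihilatingTraces_ker hu hτ⟩,
    fun h => h.1.isGoodTrace hu hsimple hdim hfin hτ h.2⟩
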